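/- Throughout, an ordinal is identified with the set of its predecessors, and a cardinal with the corresponding initial ordinal. For a set of ordinals $a$, let $\mathrm{acc}(a):=\{\delta\in a\mid \sup(a\cap\delta)=\delta>0\}$. Let $\kappa$ be a regular uncountable cardinal, and write $[\kappa]^2:=\{(\alpha,\beta)\mid \alpha<\beta<\kappa\}$. For an ordinal $\sigma$, let $[\kappa]^\sigma$ be the collection of all subsets of $\kappa$ of order type $\sigma$. For sets of ordinals $a,b$, write $a<b$ if $\alpha<\beta$ for all $\alpha\in a$ and $\beta\in b$. Let $E^\kappa_\mu:=\{\alpha<\kappa\mid \mathrm{cf}(\alpha)=\mu\}$. A $C$-sequence over $\kappa$ is a sequence $\langle C_\alpha\mid\alpha<\kappa\rangle$ such that, for every $\alpha<\kappa$, $C_\alpha$ is a closed subset of $\alpha$ with $\sup(C_\alpha)=\sup(\alpha)$. For a stationary $S\subseteq\kappa$, the proxy principle $\mathrm{P}^-(\kappa,\kappa^+,{\sqsubseteq^*},1,\{S\},2)$ asserts the existence of a $C$-sequence $\langle C_\alpha\mid\alpha<\kappa\rangle$ over $\kappa$ and a stationary subset $\Delta\subseteq S$ of $\kappa$ such that: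 (i) for all $\alpha<\kappa$ and $\delta\in\mathrm{acc}(C_\alpha)\cap\Delta$, $\sup((C_\alpha\cap\delta)\mathbin{\triangle}C_\delta)<\delta$; (ii) for every cofinal $B\subseteq\kappa$, there are stationarily many $\alpha\in\Delta$ such that $\sup\{\varepsilon\in B\cap\alpha\mid \min(C_\alpha\setminus(\varepsilon+1))\in B\}=\alpha$. For a stationary $\Gamma\subseteq\kappa$ and a cardinal $\chi\le\kappa$, the principle $\mathrm{P}\ell_2(\kappa,\Gamma,\chi)$ asserts the existence of a transformation $\mathbf t:[\kappa]^2\to[\kappa]^2$ such that: (a) for every $(\alpha,\beta)\in[\kappa]^2$, if $\mathbf t(\alpha,\beta)=(\alpha^*,\beta^*)$, then $\alpha^*\le\alpha<\beta^*\le\beta$; (b) for every ordinal $\sigma<\chi$ and every pairwise disjoint subfamily $\mathcal A\subseteq[\kappa]^\sigma$ of size $\kappa$, there exists a club $D\subseteq\kappa$ such that, for all $\alpha^*<\beta^*$ in $\Gamma\cap D$, there exist $a,b\in\mathcal A$ with $a<b$ and $\mathbf t[a\times b]=\{(\alpha^*,\beta^*)\}$. **Theorem.** Suppose that $\kappa=\mu^+$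 for some infinite regular cardinal $\mu$, and that $\mathrm{P}^-(\kappa,\kappa^+,{\sqsubseteq^*},1,\{E^\kappa_\mu\},2)$ holds. Then $\mathrm{P}\ell_2(\kappa,\kappa,\mu)$ holds. -/

import Mathlib

universe u

/-- `D` is a club (closed and unbounded) subset of the ordinal `o = {ξ | ξ < o}`. -/
def IsClubIn (D : Set Ordinal.{u}) (o : Ordinal.{u}) : Prop :=
  D ⊆ Set.Iio o ∧ IsClub ((fun ξ : Set.Iio o => (ξ : Ordinal.{u})) ⁻¹' D)

/-- `S` is a stationary subset of the ordinal `o = {ξ | ξ < o}`. -/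
def IsStationaryIn (S : Set Ordinal.{u}) (o : Ordinal.{u}) : Prop :=
  S ⊆ Set.Iio o ∧ IsStationary ((fun ξ : Set.Iio o => (ξ : Ordinal.{u})) ⁻¹' S)

/-- `B` is a cofinal subset of the ordinal `o`. -/
def IsCofinalIn (B : Set Ordinal.{u}) (o : Ordinal.{u}) : Prop :=
  B ⊆ Set.Iio o ∧ ∀ ξ < o, ∃ β ∈ B, ξ ≤ β

/-- `E^κ_μ`, the set of all ordinals below `κ` of cofinality `μ`. -/
def cofSet (κ μ : Cardinal.{u}) : Set Ordinal.{u} :=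
  {α | α < κ.ord ∧ α.cof = μ}

/-- `acc(a)`, the set of accumulation points of `a` that belong to `a`. -/
def accSet (a : Set Ordinal.{u}) : Set Ordinal.{u} :=
  {δ | δ ∈ a ∧ 0 < δ ∧ sSup (a ∩ Set.Iio δ) = δ}

/-- `⟨C α | α < κ⟩` is a `C`-sequence over `κ`: for all `α < κ`, `C α` is a closed subset of `α`
with `sup (C α) = sup α`. -/
def IsCSequence (κ : Cardinal.{u}) (C : Ordinal.{u} → Set Ordinal.{u}) : Prop :=
  ∀ α < κ.ord,
    C α ⊆ Set.Iio α ∧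
    (∀ β < α, 0 < β → sSup (C α ∩ Set.Iio β) = β → β ∈ C α) ∧
    sSup (C α) = sSup (Set.Iio α)

/-- The proxy principle `P⁻(κ, κ⁺, ⊑*, 1, {S}, 2)`, for a stationary subset `S` of `κ`. -/
def ProxyPrinciple (κ : Cardinal.{u}) (S : Set Ordinal.{u}) : Prop :=
  ∃ (C : Ordinal.{u} → Set Ordinal.{u}) (Δ : Set Ordinal.{u}),
    IsCSequence κ C ∧ Δ ⊆ S ∧ IsStationaryIn Δ κ.ord ∧
    (∀ α < κ.ord, ∀ δ ∈ accSet (C α) ∩ Δ, sSup (symmDiff (C α ∩ Set.Iio δ) (C δ)) < δ) ∧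
    (∀ B : Set Ordinal.{u}, IsCofinalIn B κ.ord →
      IsStationaryIn
        {α | α ∈ Δ ∧
          sSup {ε | ε ∈ B ∧ ε < α ∧ ∃ γ ∈ B, IsLeast (C α \ Set.Iic ε) γ} = α}
        κ.ord)

/-- The transformation principle `Pℓ₂(κ, Γ, χ)`, for a stationary subset `Γ` of `κ`. A
transformation of `[κ]² = {(α, β) | α < β < κ}` is given by a map on all pairs of ordinals whose
values outside `[κ]²` play no role. -/
def TransformationPrinciple (κ : Cardinal.{u}) (Γ : Set Ordinal.{u}) (χ : Cardinal.{u}) : Prop :=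
  ∃ t : Ordinal.{u} × Ordinal.{u} → Ordinal.{u} × Ordinal.{u},
    (∀ α β : Ordinal.{u}, α < β → β < κ.ord →
      (t (α, β)).1 ≤ α ∧ α < (t (α, β)).2 ∧ (t (α, β)).2 ≤ β) ∧
    ∀ σ < χ.ord, ∀ A : Set (Set Ordinal.{u}),
      (∀ a ∈ A, a ⊆ Set.Iio κ.ord ∧ Nonempty (a ≃o Set.Iio σ)) →
      A.PairwiseDisjoint id →
      Cardinal.mk A = Cardinal.lift.{u + 1} κ →
      ∃ D : Set Ordinal.{u}, IsClubIn D κ.ord ∧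
        ∀ α' ∈ Γ ∩ D, ∀ β' ∈ Γ ∩ D, α' < β' →
          ∃ a ∈ A, ∃ b ∈ A, (∀ x ∈ a, ∀ y ∈ b, x < y) ∧ t '' (a ×ˢ b) = {(α', β')}

/-! Fix injections `e τ : τ → μ` and a map `h : κ → κ × κ` with cofinal fibres, and put `g γ = (h
γ).2`. Walks go down along `C`, except that a step with base point `γ` goes to `g γ` when this lies
between the target and `γ`. The colour of a walk is the base point of its last step of maximal
`e`-value; `t` applies `h` to it.

If `δ ∈ Δ` and `y ≥ δ`, then for `x < δ` large enough the walk from `y` to `x` follows the walk to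
`δ` until it uses a ladder that agrees with `C δ` near `δ`. The next step is the one from `δ`. It
lands high below `δ`, so, as `cf δ = μ`, its `e`-value exceeds any prescribed `j < μ` and all
earlier values. If the remaining walk has tag at most `j`, the colour is `walkBase C δ x`
(`exists_walkColor_eq`).

In `exists_forall_rectangle`, each bad `β'` is coded by some `γ` with `h γ = (ν, β')`. The guessing
clause gives `δ` with consecutive `ε < γ` in `C δ` and a set `a` in between. The walk steps from `δ`
to `β'` with base point `γ`, so the colour decodes to `(ν, β')`, a contradiction. -/

/-! ### Preliminaries on regular cardinals. -/

open Cardinal in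
theorem exists_lt_forall_le_of_mk_lt_cof {s : Set Ordinal.{u}} {f : Ordinal.{u} → Ordinal.{u}}
    {o : Ordinal.{u}} (hs : #s < Cardinal.lift.{u + 1} o.cof) (hf : ∀ x ∈ s, f x < o) :
    ∃ η < o, ∀ x ∈ s, f x ≤ η := by
  have h1 : #(f '' s) < (Ordinal.lift.{u + 1} o).cof := by
    rw [← Ordinal.lift_cof]
    exact mk_image_le.trans_lt hs
  refine ⟨sSup (f '' s), Ordinal.sSup_lt_of_lt_cof h1 (by rintro _ ⟨x, hx, rfl⟩; exact hf x hx), ?_⟩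
  intro x hx
  exact le_csSup ⟨o, by rintro _ ⟨y, hy, rfl⟩; exact (hf y hy).le⟩ ⟨x, hx, rfl⟩

open Cardinal in
theorem mk_Iio_lt_lift_of_lt_ord {x : Ordinal.{u}} {c : Cardinal.{u}} (h : x < c.ord) :
    #(Set.Iio x) < Cardinal.lift.{u + 1} c := by
  rw [Cardinal.mk_Iio_ordinal, Cardinal.lift_lt]
  exact Cardinal.lt_ord.1 h

open Cardinal in
theorem IsClubIn.closurePoints {κ : Cardinal.{u}} (hκ : κ.IsRegular) (hω : ℵ₀ < κ)
    {g : Ordinal.{u} → Ordinal.{u}} (hg : ∀ ν < κ.ord, g ν < κ.ord) :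
    IsClubIn {δ | δ < κ.ord ∧ ∀ ν < δ, g ν ≤ δ} κ.ord := by
  have hlim := Cardinal.isSuccLimit_ord hκ.1
  refine ⟨fun δ h => h.1, ?_, ?_⟩
  · intro t ht ht0 _ x hx
    refine ⟨x.2, fun ν hν => ?_⟩
    obtain ⟨y, hy, hνy⟩ := (lt_isLUB_iff hx).1 (show (⟨ν, hν.trans x.2⟩ : Set.Iio κ.ord) < x from hν)
    exact ((ht hy).2 ν hνy).trans (hx.1 hy)
  · intro ξ
    have hb : ∀ x, ∃ y, x < κ.ord → y < κ.ord ∧ x < y ∧ ∀ ν < x, g ν ≤ y := by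
      intro x
      by_cases hx : x < κ.ord
      · obtain ⟨η, hη, h⟩ := exists_lt_forall_le_of_mk_lt_cof (s := Set.Iio x) (f := g)
          (o := κ.ord) (by rw [hκ.cof_ord]; exact mk_Iio_lt_lift_of_lt_ord hx)
          (fun y hy => hg y (lt_trans hy hx))
        exact ⟨max η (Order.succ x), fun _ => ⟨max_lt hη (hlim.succ_lt hx),
          lt_max_of_lt_right (Order.lt_succ x), fun ν hν => le_max_of_le_left (h ν hν)⟩⟩
      · exact ⟨0, fun h => absurd h hx⟩
    choose f hf using hb
    have hlt : Ordinal.nfp f ξ < κ.ord :=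
      Ordinal.nfp_lt_ord (by rw [hκ.cof_ord]; exact hω) (fun i hi => (hf i hi).1) ξ.2
    have hit : ∀ n, f^[n] ξ < κ.ord := fun n => (Ordinal.iterate_le_nfp f ξ n).trans_lt hlt
    refine ⟨⟨Ordinal.nfp f ξ, hlt⟩, ⟨hlt, fun ν hν => ?_⟩, Ordinal.le_nfp f ξ⟩
    obtain ⟨n, hn⟩ := Ordinal.lt_nfp_iff.1 hν
    refine ((hf _ (hit n)).2.2 ν hn).trans ?_
    rw [← Function.iterate_succ_apply' f]
    exact Ordinal.iterate_le_nfp f ξ _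

open Cardinal in
theorem exists_injOn_Iio_of_lt_ord_succ (μ : Cardinal.{u}) :
    ∃ e : Ordinal.{u} → Ordinal.{u} → Ordinal.{u}, ∀ τ < (Order.succ μ).ord,
      Set.InjOn (e τ) (Set.Iio τ) ∧ ∀ x < τ, e τ x < μ.ord := by
  have h : ∀ τ, ∃ f : Ordinal.{u} → Ordinal.{u}, τ < (Order.succ μ).ord →
      Set.InjOn f (Set.Iio τ) ∧ ∀ x < τ, f x < μ.ord := by
    intro τ
    by_cases hτ : τ < (Order.succ μ).ord
    · have h1 : #(Set.Iio τ) ≤ #(Set.Iio μ.ord) := by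
        rw [Cardinal.mk_Iio_ordinal, Cardinal.mk_Iio_ordinal, Cardinal.lift_le, Cardinal.card_ord]
        exact Order.lt_succ_iff.1 (Cardinal.lt_ord.1 hτ)
      obtain ⟨f⟩ := h1
      refine ⟨fun x => if hx : x < τ then f ⟨x, hx⟩ else 0, fun _ => ⟨?_, ?_⟩⟩
      · intro x hx y hy hxy
        simp only [Set.mem_Iio] at hx hy
        simp only [hx, hy, dif_pos] at hxy
        exact Subtype.mk.inj (f.injective (Subtype.ext hxy))
      · intro x hx
        simp only [hx, dif_pos]
        exact (f ⟨x, hx⟩).2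
    · exact ⟨id, fun h => absurd h hτ⟩
  choose e he using h
  exact ⟨e, he⟩

-- Through a bijection of `κ` with `κ × κ × κ`, the unused first coordinate makes every fibre of
-- size `κ`, hence unbounded.
open Cardinal in
theorem exists_cofinal_fibers {κ : Cardinal.{u}} (hκ : ℵ₀ ≤ κ) :
    ∃ h : Ordinal.{u} → Ordinal.{u} × Ordinal.{u}, ∀ ν < κ.ord, ∀ β < κ.ord, ∀ ζ < κ.ord,
      ∃ γ < κ.ord, ζ ≤ γ ∧ h γ = (ν, β) := by
  let I := Set.Iio κ.ord
  have hI : #I = Cardinal.lift.{u + 1} κ := by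
    rw [Cardinal.mk_Iio_ordinal, Cardinal.card_ord]
  have hinf : ℵ₀ ≤ #I := by rw [hI]; simpa using hκ
  have hmk : #I = #(I × I × I) := by
    simp [Cardinal.mul_eq_self hinf]
  obtain ⟨F⟩ := Cardinal.eq.1 hmk
  refine ⟨fun γ => if hγ : γ < κ.ord then ((F ⟨γ, hγ⟩).2.1, (F ⟨γ, hγ⟩).2.2) else (0, 0), ?_⟩
  intro ν hν β hβ ζ hζ
  by_contra! hcon
  have key : ∀ i : I, (F.symm (i, ⟨ν, hν⟩, ⟨β, hβ⟩) : Ordinal.{u}) < ζ := by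
    intro i
    by_contra! hle
    refine hcon _ (F.symm (i, ⟨ν, hν⟩, ⟨β, hβ⟩)).2 hle ?_
    rw [dif_pos (show _ < κ.ord from (F.symm (i, ⟨ν, hν⟩, ⟨β, hβ⟩)).2), Subtype.coe_eta,
      F.apply_symm_apply]
  have hle : #I ≤ #(Set.Iio ζ) := by
    refine Cardinal.mk_le_of_injective (f := fun i => ⟨F.symm (i, ⟨ν, hν⟩, ⟨β, hβ⟩), key i⟩) ?_
    intro i i' hii
    have := F.symm.injective (Subtype.ext (Subtype.mk.inj hii))
    exact (Prod.mk.inj this).1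
  exact (hle.trans_lt (mk_Iio_lt_lift_of_lt_ord hζ)).ne hI

open Cardinal in
theorem exists_mem_forall_lt {κ : Cardinal.{u}} (hκ : ℵ₀ ≤ κ) {A : Set (Set Ordinal.{u})}
    (hA : A.PairwiseDisjoint id) (hmk : #A = Cardinal.lift.{u + 1} κ) {ζ : Ordinal.{u}}
    (hζ : ζ < κ.ord) : ∃ a ∈ A, ∀ x ∈ a, ζ < x := by
  by_contra! h
  choose! f hfa hf using h
  have hζ' := (Cardinal.isSuccLimit_ord hκ).succ_lt hζ
  have hle : #A ≤ #(Set.Iio (Order.succ ζ)) := by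
    refine Cardinal.mk_le_of_injective
      (f := fun a => ⟨f a, Order.lt_succ_iff.2 (hf a a.2)⟩) ?_
    intro a b hab
    have hab : f a = f b := Subtype.mk.inj hab
    by_contra hne
    exact Set.disjoint_left.1 (hA a.2 b.2 fun h => hne (Subtype.ext h)) (hfa a a.2)
      (hab ▸ hfa b b.2)
  exact (hle.trans_lt (mk_Iio_lt_lift_of_lt_ord hζ')).ne hmk

/-! ### Walks with jumps, their tags and colours. -/

/-- The least element of `C τ` that is not below `α`. -/
noncomputable def walkBase (C : Ordinal.{u} → Set Ordinal.{u}) (τ α : Ordinal.{u}) : Ordinal.{u} :=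
  sInf (C τ \ Set.Iio α)

/-- The step from `τ` towards `α`: the least element `γ` of `C τ` that is not below `α`, or `g γ`
if that is a better approximation of `α`. -/
noncomputable def walkStep (C : Ordinal.{u} → Set Ordinal.{u}) (g : Ordinal.{u} → Ordinal.{u})
    (τ α : Ordinal.{u}) : Ordinal.{u} :=
  open Classical in
  if α ≤ g (walkBase C τ α) ∧ g (walkBase C τ α) ≤ walkBase C τ α then g (walkBase C τ α)
  else walkBase C τ α

/-- The largest value of `e` on the steps of the walk from `τ` to `α`. -/
noncomputable def walkTag (C : Ordinal.{u} → Set Ordinal.{u}) (g : Ordinal.{u} → Ordinal.{u})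
    (e : Ordinal.{u} → Ordinal.{u} → Ordinal.{u}) (τ α : Ordinal.{u}) : Ordinal.{u} :=
  open Classical in
  if _h : α < τ ∧ walkStep C g τ α < τ then
    max (e τ (walkStep C g τ α)) (walkTag C g e (walkStep C g τ α) α)
  else 0
termination_by τ
decreasing_by exact _h.2

/-- The base point of the last step with the largest value of `e` in the walk from `τ` to `α`. -/
noncomputable def walkColor (C : Ordinal.{u} → Set Ordinal.{u}) (g : Ordinal.{u} → Ordinal.{u})
    (e : Ordinal.{u} → Ordinal.{u} → Ordinal.{u}) (τ α : Ordinal.{u}) : Ordinal.{u} :=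
  open Classical in
  if _h : α < τ ∧ walkStep C g τ α < τ then
    if walkTag C g e (walkStep C g τ α) α < e τ (walkStep C g τ α) then walkBase C τ α
    else walkColor C g e (walkStep C g τ α) α
  else 0
termination_by τ
decreasing_by exact _h.2

section Walk

variable {κ μ : Cardinal.{u}} {C : Ordinal.{u} → Set Ordinal.{u}} {g : Ordinal.{u} → Ordinal.{u}}
  {e : Ordinal.{u} → Ordinal.{u} → Ordinal.{u}}

theorem walkTag_eq_max {τ α : Ordinal.{u}} (hα : α < τ) (hs : walkStep C g τ α < τ) :
    walkTag C g e τ α = max (e τ (walkStep C g τ α)) (walkTag C g e (walkStep C g τ α) α) := by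
  rw [walkTag, dif_pos ⟨hα, hs⟩]

theorem walkColor_eq_walkBase {τ α : Ordinal.{u}} (hα : α < τ) (hs : walkStep C g τ α < τ)
    (h : walkTag C g e (walkStep C g τ α) α < e τ (walkStep C g τ α)) :
    walkColor C g e τ α = walkBase C τ α := by
  rw [walkColor, dif_pos ⟨hα, hs⟩, if_pos h]

theorem walkColor_eq_walkColor {τ α : Ordinal.{u}} (hα : α < τ) (hs : walkStep C g τ α < τ)
    (h : e τ (walkStep C g τ α) ≤ walkTag C g e (walkStep C g τ α) α) :
    walkColor C g e τ α = walkColor C g e (walkStep C g τ α) α := by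
  rw [walkColor, dif_pos ⟨hα, hs⟩, if_neg h.not_gt]

theorem walkTag_lt (hμ : 0 < μ.ord) (he : ∀ τ < κ.ord, ∀ x < τ, e τ x < μ.ord) (τ α : Ordinal.{u})
    (hτ : τ < κ.ord) : walkTag C g e τ α < μ.ord := by
  induction τ using WellFoundedLT.induction with
  | ind τ ih =>
    rw [walkTag]
    split_ifs with h
    · exact max_lt (he τ hτ _ h.2) (ih _ h.2 (h.2.trans hτ))
    · exact hμ

/-- If `C τ` were contained in `α`, its supremum would be exactly `α`, and closedness would put `α`
into `C τ`. This covers successor `τ` as well. -/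
theorem IsCSequence.isLeast_walkBase (hC : IsCSequence κ C) {τ α : Ordinal.{u}} (hτ : τ < κ.ord)
    (hα : 0 < α) (hατ : α < τ) : IsLeast (C τ \ Set.Iio α) (walkBase C τ α) := by
  obtain ⟨hsub, hcl, hsup⟩ := hC τ hτ
  have hne : (C τ \ Set.Iio α).Nonempty := by
    by_contra hemp
    have hlt : C τ ⊆ Set.Iio α := Set.sdiff_eq_empty.1 (Set.not_nonempty_iff_eq_empty.1 hemp)
    have h1 : sSup (C τ) = α := by
      apply le_antisymm
      · exact csSup_le' fun x hx => (hlt hx).le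
      · rw [hsup]
        exact le_csSup ⟨τ, fun x hx => le_of_lt hx⟩ hατ
    have h2 := hcl α hατ hα (by rwa [Set.inter_eq_left.2 hlt])
    exact lt_irrefl α (hlt h2)
  exact ⟨csInf_mem hne, fun x hx => csInf_le (OrderBot.bddBelow _) hx⟩

theorem walkBase_eq {τ α γ : Ordinal.{u}} (h : IsLeast (C τ \ Set.Iio α) γ) :
    walkBase C τ α = γ := h.csInf_eq

theorem walkStep_congr {τ τ' α : Ordinal.{u}} (h : walkBase C τ α = walkBase C τ' α) :
    walkStep C g τ α = walkStep C g τ' α := by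
  simp only [walkStep, h]

theorem IsCSequence.walkStep_mem (hC : IsCSequence κ C) {τ α : Ordinal.{u}} (hτ : τ < κ.ord)
    (hα : 0 < α) (hατ : α < τ) : α ≤ walkStep C g τ α ∧ walkStep C g τ α < τ := by
  have h := (hC.isLeast_walkBase hτ hα hατ).1
  have h1 := (hC τ hτ).1 h.1
  rw [walkStep]
  split_ifs with h2
  · exact ⟨h2.1, h2.2.trans_lt h1⟩
  · exact ⟨not_lt.1 h.2, h1⟩

/-- If `δ` is not an accumulation point of `C τ`, then the steps from `τ` towards `δ` and towards
all ordinals below `δ` that are large enough agree. -/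
theorem IsCSequence.exists_walkStep_eq (hC : IsCSequence κ C) {τ δ : Ordinal.{u}} (hτ : τ < κ.ord)
    (hδτ : δ < τ) (hδ : 0 < δ) (hsup : sSup (C τ ∩ Set.Iio δ) < δ) :
    ∃ η < δ, ∀ α, η < α → α < δ → walkStep C g τ α = walkStep C g τ δ := by
  have hb := hC.isLeast_walkBase hτ hδ hδτ
  -- When the jump value lies below `δ`, `η` has to bound it too, so that the jump is rejected for
  -- `α` exactly as for `δ`.
  obtain ⟨η, hη, hη1, hη2⟩ : ∃ η < δ, sSup (C τ ∩ Set.Iio δ) ≤ η ∧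
      (g (walkBase C τ δ) < δ → g (walkBase C τ δ) ≤ η) := by
    by_cases h : g (walkBase C τ δ) < δ
    · exact ⟨max (sSup (C τ ∩ Set.Iio δ)) (g (walkBase C τ δ)), max_lt hsup h, le_max_left _ _,
        fun _ => le_max_right _ _⟩
    · exact ⟨_, hsup, le_rfl, fun h' => absurd h' h⟩
  refine ⟨η, hη, fun α hηα hαδ => ?_⟩
  have hbα : walkBase C τ α = walkBase C τ δ := by
    refine walkBase_eq ⟨⟨hb.1.1, fun h => hb.1.2 (lt_trans h hαδ)⟩, fun x hx => ?_⟩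
    by_cases hxδ : x < δ
    · have : x ≤ sSup (C τ ∩ Set.Iio δ) := le_csSup ⟨δ, fun y hy => le_of_lt hy.2⟩ ⟨hx.1, hxδ⟩
      exact absurd (this.trans hη1 |>.trans_lt hηα) hx.2
    · exact hb.2 ⟨hx.1, hxδ⟩
  have hiff : α ≤ g (walkBase C τ δ) ↔ δ ≤ g (walkBase C τ δ) := by
    refine ⟨fun h => ?_, fun h => hαδ.le.trans h⟩
    by_contra! hlt
    exact ((hη2 hlt).trans_lt hηα).not_ge h
  simp only [walkStep, hbα, hiff]

/-- If `C τ` and `C δ` agree below `δ` up to a bounded set, then the base points from `τ` and from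
`δ` agree for all ordinals below `δ` that are large enough. -/
theorem IsCSequence.exists_walkBase_eq (hC : IsCSequence κ C) {τ δ : Ordinal.{u}} (hδ : δ < κ.ord)
    (hsymm : sSup (symmDiff (C τ ∩ Set.Iio δ) (C δ)) < δ) :
    ∃ η < δ, ∀ α, η < α → α < δ → walkBase C τ α = walkBase C δ α := by
  refine ⟨_, hsymm, fun α hηα hαδ => ?_⟩
  have hα : 0 < α := zero_le.trans_lt hηα
  have hb := hC.isLeast_walkBase hδ hα hαδ
  have hCδ := (hC δ hδ).1
  have hagree : ∀ x, α ≤ x → x < δ → (x ∈ C τ ↔ x ∈ C δ) := by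
    intro x hαx hxδ
    by_contra hne
    have hx : x ∈ symmDiff (C τ ∩ Set.Iio δ) (C δ) := by
      rw [Set.mem_symmDiff]
      simp only [Set.mem_inter_iff, Set.mem_Iio, hxδ, and_true]
      tauto
    have : x ≤ sSup (symmDiff (C τ ∩ Set.Iio δ) (C δ)) := by
      refine le_csSup ⟨δ, ?_⟩ hx
      rintro y (hy | hy)
      · exact le_of_lt hy.1.2
      · exact le_of_lt (hCδ hy.1)
    exact ((hηα.trans_le hαx).trans_le this).false
  have hbδ : walkBase C δ α < δ := hCδ hb.1.1
  refine walkBase_eq ⟨⟨(hagree _ (not_lt.1 hb.1.2) hbδ).2 hb.1.1, hb.1.2⟩, fun x hx => ?_⟩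
  by_cases hxδ : x < δ
  · exact hb.2 ⟨(hagree x (not_lt.1 hx.2) hxδ).1 hx.1, hx.2⟩
  · exact hbδ.le.trans (not_lt.1 hxδ)

/-- An injection from `τ` to `μ` is eventually large below every ordinal of cofinality `μ`. -/
theorem exists_lt_forall_lt_of_injOn {τ δ j : Ordinal.{u}} {f : Ordinal.{u} → Ordinal.{u}}
    (hf : Set.InjOn f (Set.Iio τ)) (hμ : μ.IsRegular) (hδ : δ.cof = μ) (hδτ : δ ≤ τ)
    (hj : j < μ.ord) : ∃ η < δ, ∀ x, η < x → x < δ → j < f x := by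
  have hj' := (Cardinal.isSuccLimit_ord hμ.1).succ_lt hj
  -- By injectivity fewer than `μ = cf δ` points have value at most `j`, so they are bounded in `δ`.
  obtain ⟨η, hη, h⟩ := exists_lt_forall_le_of_mk_lt_cof (s := {x | x < δ ∧ f x ≤ j}) (f := id)
    (o := δ) (by
      rw [hδ]
      refine lt_of_le_of_lt ?_ (mk_Iio_lt_lift_of_lt_ord hj')
      refine Cardinal.mk_le_of_injective
        (f := fun x => (⟨f x, Order.lt_succ_iff.2 x.2.2⟩ : Set.Iio (Order.succ j))) ?_
      intro x y hxy
      exact Subtype.ext (hf (x.2.1.trans_le hδτ) (y.2.1.trans_le hδτ) (Subtype.mk.inj hxy)))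
    (fun x hx => hx.1)
  refine ⟨η, hη, fun x hηx hxδ => ?_⟩
  by_contra! hle
  exact (h x ⟨hxδ, hle⟩).not_gt hηx

/-- The walk from `β` to an ordinal `α` that is large enough below `δ` takes the same step as at
`δ`, and this step decides the color if the rest of the walk has small tags. -/
theorem IsCSequence.exists_walkColor_eq (hC : IsCSequence κ C)
    (he : ∀ τ < κ.ord, Set.InjOn (e τ) (Set.Iio τ) ∧ ∀ x < τ, e τ x < μ.ord) (hμ : μ.IsRegular)
    {δ : Ordinal.{u}} (hδ : δ.cof = μ)
    (hcoh : ∀ τ < κ.ord, δ ∈ accSet (C τ) → sSup (symmDiff (C τ ∩ Set.Iio δ) (C δ)) < δ)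
    (β : Ordinal.{u}) (hδβ : δ ≤ β) (hβ : β < κ.ord) (j : Ordinal.{u}) (hj : j < μ.ord) :
    ∃ η < δ, ∀ α, η < α → α < δ → walkTag C g e (walkStep C g δ α) α ≤ j →
      walkColor C g e β α = walkBase C δ α ∧ j < walkTag C g e β α := by
  have hδ0 : 0 < δ := by
    rw [← Ordinal.cof_pos, hδ]
    exact hμ.pos
  have hδκ := hδβ.trans_lt hβ
  induction β using WellFoundedLT.induction generalizing j with
  | ind β ih =>
    -- Agreement marks the end of the common initial part of the walks; it covers both `β = δ` and
    -- `δ ∈ acc (C β)`.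
    by_cases hagree : ∃ η < δ, ∀ α, η < α → α < δ → walkBase C β α = walkBase C δ α
    · obtain ⟨η₁, hη₁, h₁⟩ := hagree
      obtain ⟨η₂, hη₂, h₂⟩ := exists_lt_forall_lt_of_injOn (he β hβ).1 hμ hδ hδβ hj
      refine ⟨max η₁ η₂, max_lt hη₁ hη₂, fun α hα hαδ htag => ?_⟩
      obtain ⟨hα₁, hα₂⟩ := max_lt_iff.1 hα
      have hα0 : 0 < α := zero_le.trans_lt hα₁
      have hb := h₁ α hα₁ hαδ
      have hs := walkStep_congr (g := g) hb
      have hm := hC.walkStep_mem (g := g) hδκ hα0 hαδ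
      have hej := h₂ _ (hα₂.trans_le hm.1) hm.2
      have hαβ := hαδ.trans_le hδβ
      have hsβ : walkStep C g β α < β := hs ▸ hm.2.trans_le hδβ
      rw [walkColor_eq_walkBase hαβ hsβ (by rw [hs]; exact htag.trans_lt hej),
        walkTag_eq_max hαβ hsβ, hs]
      exact ⟨hb, lt_max_of_lt_left hej⟩
    · have hδβ' : δ < β := by
        refine lt_of_le_of_ne hδβ fun h => hagree ⟨0, hδ0, fun α _ _ => by rw [h]⟩
      have hsup : sSup (C β ∩ Set.Iio δ) < δ := by
        refine lt_of_le_of_ne (csSup_le' fun x hx => le_of_lt hx.2) fun h => hagree ?_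
        exact hC.exists_walkBase_eq hδκ (hcoh β hβ ⟨(hC β hβ).2.1 δ hδβ' hδ0 h, hδ0, h⟩)
      have hm := hC.walkStep_mem (g := g) hβ hδ0 hδβ'
      obtain ⟨η₁, hη₁, h₁⟩ := hC.exists_walkStep_eq (g := g) hβ hδβ' hδ0 hsup
      -- The bound `j` is raised to include the `e`-value of the present step, so that the later
      -- decisive step beats it.
      obtain ⟨η₂, hη₂, h₂⟩ := ih _ hm.2 hm.1 (hm.2.trans hβ)
        (max j (e β (walkStep C g β δ))) (max_lt hj ((he β hβ).2 _ hm.2))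
      refine ⟨max η₁ η₂, max_lt hη₁ hη₂, fun α hα hαδ htag => ?_⟩
      obtain ⟨hα₁, hα₂⟩ := max_lt_iff.1 hα
      obtain ⟨hc, ht⟩ := h₂ α hα₂ hαδ (htag.trans (le_max_left _ _))
      obtain ⟨ht₁, ht₂⟩ := max_lt_iff.1 ht
      have hs := h₁ α hα₁ hαδ
      have hαβ := hαδ.trans hδβ'
      have hsβ : walkStep C g β α < β := hs ▸ hm.2
      rw [walkColor_eq_walkColor hαβ hsβ (by rw [hs]; exact ht₂.le), walkTag_eq_max hαβ hsβ, hs]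
      exact ⟨hc, lt_max_of_lt_right ht₁⟩

end Walk

/-! ### Rectangles of constant colour. -/

open Cardinal in
theorem mk_eq_of_nonempty_orderIso_Iio {a : Set Ordinal.{u}} {σ : Ordinal.{u}}
    (h : Nonempty (a ≃o Set.Iio σ)) : #a = Cardinal.lift.{u + 1} σ.card := by
  rw [← Cardinal.mk_Iio_ordinal]
  exact Cardinal.mk_congr h.some.toEquiv

/-- For a fixed `ν`, all ordinals `β'` large enough are such that the pair `(ν, β')` is the color of
a rectangle `a × b` with `a ⊆ [ν, β')` and `b` above `β'`. -/
theorem exists_forall_rectangle {κ μ : Cardinal.{u}} (hμ : μ.IsRegular) (hκ : κ = Order.succ μ)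
    {C : Ordinal.{u} → Set Ordinal.{u}} {Δ : Set Ordinal.{u}} (hC : IsCSequence κ C)
    (hΔ : Δ ⊆ cofSet κ μ)
    (hcoh : ∀ α < κ.ord, ∀ δ ∈ accSet (C α) ∩ Δ, sSup (symmDiff (C α ∩ Set.Iio δ) (C δ)) < δ)
    (hhit : ∀ B : Set Ordinal.{u}, IsCofinalIn B κ.ord → ∃ α ∈ Δ,
      sSup {ε | ε ∈ B ∧ ε < α ∧ ∃ γ ∈ B, IsLeast (C α \ Set.Iic ε) γ} = α)
    {e : Ordinal.{u} → Ordinal.{u} → Ordinal.{u}}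
    (he : ∀ τ < κ.ord, Set.InjOn (e τ) (Set.Iio τ) ∧ ∀ x < τ, e τ x < μ.ord)
    {h : Ordinal.{u} → Ordinal.{u} × Ordinal.{u}}
    (hh : ∀ ν < κ.ord, ∀ β < κ.ord, ∀ ζ < κ.ord, ∃ γ < κ.ord, ζ ≤ γ ∧ h γ = (ν, β))
    {A : Set (Set Ordinal.{u})} (hAκ : ∀ a ∈ A, a ⊆ Set.Iio κ.ord)
    (hAμ : ∀ a ∈ A, Cardinal.mk a < Cardinal.lift.{u + 1} μ) (hAd : A.PairwiseDisjoint id)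
    (hA : Cardinal.mk A = Cardinal.lift.{u + 1} κ) {ν : Ordinal.{u}} (hν : ν < κ.ord) :
    ∃ ζ < κ.ord, ∀ β', ζ ≤ β' → β' < κ.ord → ∃ a ∈ A, ∃ b ∈ A, (∀ x ∈ a, ν ≤ x ∧ x < β') ∧
      (∀ y ∈ b, β' ≤ y) ∧
      ∀ x ∈ a, ∀ y ∈ b, h (walkColor C (fun γ => (h γ).2) e y x) = (ν, β') := by
  have hκr : κ.IsRegular := hκ ▸ Cardinal.isRegular_succ hμ.1
  have hμκ : μ < κ := hκ ▸ Order.lt_succ μ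
  have hκω : Cardinal.aleph0 < κ := hμ.1.trans_lt hμκ
  by_contra! hbad
  set g : Ordinal.{u} → Ordinal.{u} := fun γ => (h γ).2 with hg
  have h1 : ∀ ζ, ∃ a β' j, ζ < κ.ord → a ∈ A ∧ (∀ x ∈ a, ζ < x ∧ ν < x ∧ x < β') ∧ ζ ≤ β' ∧
      β' < κ.ord ∧ j < μ.ord ∧ (∀ x ∈ a, walkTag C g e β' x ≤ j) ∧
      ∀ b ∈ A, (∀ y ∈ b, β' ≤ y) → ∃ x ∈ a, ∃ y ∈ b, h (walkColor C g e y x) ≠ (ν, β') := by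
    intro ζ
    by_cases hζ : ζ < κ.ord
    swap
    · exact ⟨∅, 0, 0, fun h => absurd h hζ⟩
    obtain ⟨a, ha, hζa⟩ := exists_mem_forall_lt hκω.le hAd hA (max_lt hζ hν)
    obtain ⟨η, hη, hηa⟩ := exists_lt_forall_le_of_mk_lt_cof (s := a) (f := id) (o := κ.ord)
      (by
        rw [hκr.cof_ord]
        exact (hAμ a ha).trans (Cardinal.lift_lt.2 hμκ))
      (fun x hx => hAκ a ha hx)
    obtain ⟨β', hβ', hβκ, hβ⟩ := hbad _ (max_lt hζ
      ((Cardinal.isSuccLimit_ord hκr.1).succ_lt hη))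
    -- One bound serves all of `a`, because `a` has fewer than `μ` elements and `μ` is regular.
    obtain ⟨j, hj, hja⟩ := exists_lt_forall_le_of_mk_lt_cof (s := a)
      (f := fun x => walkTag C g e β' x) (o := μ.ord)
      (by
        rw [hμ.cof_ord]
        exact hAμ a ha)
      (fun x _ => walkTag_lt hμ.ord_pos (fun τ hτ => (he τ hτ).2) β' x hβκ)
    have hax : ∀ x ∈ a, ζ < x ∧ ν < x ∧ x < β' := fun x hx =>
      ⟨(le_max_left _ _).trans_lt (hζa x hx), (le_max_right _ _).trans_lt (hζa x hx),
        (Order.lt_succ_iff.2 (hηa x hx)).trans_le ((le_max_right _ _).trans hβ')⟩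
    exact ⟨a, β', j, fun _ => ⟨ha, hax, (le_max_left _ _).trans hβ', hβκ, hj, hja,
      fun b hb hby => hβ a ha b hb (fun x hx => ⟨(hax x hx).2.1.le, (hax x hx).2.2⟩) hby⟩⟩
  choose a β' j h1 using h1
  -- There are only `μ < κ` possible bounds, so a single `i` works for cofinally many `ζ`.
  obtain ⟨i, hi, h2⟩ : ∃ i < μ.ord, ∀ ζ < κ.ord, ∃ ζ', ζ ≤ ζ' ∧ ζ' < κ.ord ∧ j ζ' ≤ i := by
    by_contra! hcon
    choose! k hkκ hk using hcon
    obtain ⟨K, hK, hkK⟩ := exists_lt_forall_le_of_mk_lt_cof (s := Set.Iio μ.ord) (f := k)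
      (o := κ.ord)
      (by
        rw [hκr.cof_ord]
        exact mk_Iio_lt_lift_of_lt_ord (Cardinal.ord_lt_ord.2 hμκ))
      hkκ
    have hjK := (h1 K hK).2.2.2.2.1
    exact (hk _ hjK K (hkK _ hjK) hK).false
  -- The code `γ` is taken above `β'`, so that the jump from `γ` to `g γ = β'` is admissible.
  have h3 : ∀ ζ, ∃ γ ζ', ζ < κ.ord →
      γ < κ.ord ∧ ζ ≤ ζ' ∧ ζ' < κ.ord ∧ j ζ' ≤ i ∧ β' ζ' ≤ γ ∧ h γ = (ν, β' ζ') := by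
    intro ζ
    by_cases hζ : ζ < κ.ord
    · obtain ⟨ζ', hζζ', hζ', hj⟩ := h2 ζ hζ
      have hβ := (h1 ζ' hζ').2.2.2.1
      obtain ⟨γ, hγ, hβγ, hhγ⟩ := hh ν hν _ hβ _ hβ
      exact ⟨γ, ζ', fun _ => ⟨hγ, hζζ', hζ', hj, hβγ, hhγ⟩⟩
    · exact ⟨0, 0, fun h => absurd h hζ⟩
  choose F z h3 using h3
  have hζF : ∀ ζ < κ.ord, ζ ≤ F ζ := fun ζ hζ =>
    (h3 ζ hζ).2.1.trans (((h1 _ (h3 ζ hζ).2.2.1).2.2.1).trans (h3 ζ hζ).2.2.2.2.1)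
  -- For `ζ₁ < ζ₂` in this club, `F ζ₁ ≤ ζ₂`, so the set `a` chosen for `F ζ₂` lies entirely above
  -- `F ζ₁`.
  have hE := IsClubIn.closurePoints hκr hκω (fun ζ hζ => (h3 ζ hζ).1)
  set E := {δ | δ < κ.ord ∧ ∀ ν < δ, F ν ≤ δ}
  have hB : IsCofinalIn (F '' E) κ.ord := by
    refine ⟨?_, fun ξ hξ => ?_⟩
    · rintro _ ⟨δ, hδ, rfl⟩
      exact (h3 δ hδ.1).1
    · obtain ⟨δ, hδ, hξδ⟩ := hE.2.isCofinal ⟨ξ, hξ⟩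
      exact ⟨F δ, ⟨δ, hδ, rfl⟩, le_trans hξδ (hζF _ δ.2)⟩
  obtain ⟨δ, hδΔ, hδsup⟩ := hhit _ hB
  obtain ⟨hδκ, hδcof⟩ := hΔ hδΔ
  obtain ⟨b, hb, hδb⟩ := exists_mem_forall_lt hκω.le hAd hA hδκ
  have h4 : ∀ y, ∃ η, y ∈ b → η < δ ∧ ∀ α, η < α → α < δ →
      walkTag C g e (walkStep C g δ α) α ≤ i → walkColor C g e y α = walkBase C δ α := by
    intro y
    by_cases hy : y ∈ b
    · obtain ⟨η, hη, hηy⟩ := hC.exists_walkColor_eq (g := g) he hμ hδcof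
        (fun τ hτ hδ => hcoh τ hτ δ ⟨hδ, hδΔ⟩) y (hδb y hy).le (hAκ b hb hy) i hi
      exact ⟨η, fun _ => ⟨hη, fun α h h' ht => (hηy α h h' ht).1⟩⟩
    · exact ⟨0, fun h => absurd h hy⟩
  choose η h4 using h4
  obtain ⟨ξ, hξ, hηξ⟩ := exists_lt_forall_le_of_mk_lt_cof (s := b) (f := η) (o := δ)
    (by
      rw [hδcof]
      exact hAμ b hb)
    (fun y hy => (h4 y hy).1)
  -- `ξ` is below `δ` and bounds the thresholds of all `y ∈ b`; the guessing at `δ` supplies `ε = F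
  -- ζ₁` above it, followed in `C δ` by `F ζ₂`.
  rw [← hδsup] at hξ
  obtain ⟨_, ⟨⟨ζ₁, hζ₁, rfl⟩, hεδ, _, ⟨ζ₂, hζ₂, rfl⟩, hleast⟩, hξε⟩ := exists_lt_of_lt_csSup' hξ
  have hlt : F ζ₁ < F ζ₂ := not_le.1 hleast.1.2
  have hζ : ζ₁ < ζ₂ := by
    rcases lt_trichotomy ζ₁ ζ₂ with hlt' | rfl | hgt
    · exact hlt'
    · exact absurd hlt (lt_irrefl _)
    · exact absurd ((hζ₁.2 _ hgt).trans (hζF _ hζ₁.1)) hlt.not_ge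
  obtain ⟨-, hzz, hzκ, hji, hβγ, hhγ⟩ := h3 ζ₂ hζ₂.1
  obtain ⟨-, hax, -, -, -, htag, hcon⟩ := h1 _ hzκ
  have hγδ : F ζ₂ < δ := (hC δ hδκ).1 hleast.1.1
  obtain ⟨x, hx, y, hy, hne⟩ := hcon b hb fun y hy => hβγ.trans (hγδ.trans (hδb y hy)).le
  have hεx : F ζ₁ < x := ((hζ₂.2 _ hζ).trans hzz).trans_lt (hax x hx).1
  have hxγ : x < F ζ₂ := (hax x hx).2.2.trans_le hβγ
  -- No point of `C δ` lies strictly between `F ζ₁` and `F ζ₂`, whereas `x` does.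
  have hbase : walkBase C δ x = F ζ₂ :=
    walkBase_eq ⟨⟨hleast.1.1, hxγ.not_gt⟩, fun w hw =>
      hleast.2 ⟨hw.1, fun hwε => hw.2 (lt_of_le_of_lt hwε hεx)⟩⟩
  have hgγ : g (F ζ₂) = β' (z ζ₂) := by rw [hg]; simp only [hhγ]
  have hstep : walkStep C g δ x = β' (z ζ₂) := by
    rw [walkStep, hbase, hgγ, if_pos ⟨(hax x hx).2.2.le, hβγ⟩]
  refine hne ?_
  rw [(h4 y hy).2 x ((hηξ y hy).trans_lt (hξε.trans hεx)) (hxγ.trans hγδ)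
    (by rw [hstep]; exact (htag x hx).trans hji), hbase, hhγ]

/-! ### The transformation. -/

theorem mainTheorem11 (μ κ : Cardinal.{u}) (hμ : μ.IsRegular) (hκ : κ = Order.succ μ)
    (hP : ProxyPrinciple κ (cofSet κ μ)) :
    TransformationPrinciple κ (Set.Iio κ.ord) μ := by
  obtain ⟨C, Δ, hC, hΔ, -, hcoh, hhit⟩ := hP
  have hκr : κ.IsRegular := hκ ▸ Cardinal.isRegular_succ hμ.1
  have hκω : Cardinal.aleph0 < κ := hμ.1.trans_lt (hκ ▸ Order.lt_succ μ)
  have hhit' : ∀ B : Set Ordinal.{u}, IsCofinalIn B κ.ord → ∃ α ∈ Δ,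
      sSup {ε | ε ∈ B ∧ ε < α ∧ ∃ γ ∈ B, IsLeast (C α \ Set.Iic ε) γ} = α := by
    intro B hB
    obtain ⟨α, hα⟩ := (hhit B hB).2.nonempty
    exact ⟨α, hα.1, hα.2⟩
  obtain ⟨e, he⟩ := exists_injOn_Iio_of_lt_ord_succ μ
  rw [← hκ] at he
  obtain ⟨h, hh⟩ := exists_cofinal_fibers hκω.le
  classical
  let c : Ordinal.{u} → Ordinal.{u} → Ordinal.{u} × Ordinal.{u} := fun α β =>
    h (walkColor C (fun γ => (h γ).2) e β α)
  -- The pair itself is the default value, so clause (a) holds for every pair.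
  refine ⟨fun p => if (c p.1 p.2).1 ≤ p.1 ∧ p.1 < (c p.1 p.2).2 ∧ (c p.1 p.2).2 ≤ p.2 then
    c p.1 p.2 else p, ?_, ?_⟩
  · intro α β hαβ _
    dsimp only
    split_ifs with hc
    · exact hc
    · exact ⟨le_rfl, hαβ, le_rfl⟩
  intro σ hσ A hA hAd hAκ
  -- An empty member forces `σ = 0`, leaving `A` at most one element; nonemptiness makes the image a
  -- singleton rather than empty.
  have hne : ∀ a ∈ A, a.Nonempty := by
    intro a ha
    by_contra hemp
    rw [Set.not_nonempty_iff_eq_empty] at hemp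
    have hσ0 : ∀ b ∈ A, b = a := by
      intro b hb
      obtain ⟨f⟩ := (hA a ha).2
      obtain ⟨f'⟩ := (hA b hb).2
      rw [hemp]
      refine Set.eq_empty_of_forall_notMem fun x hx => ?_
      exact Set.eq_empty_iff_forall_notMem.1 hemp _ (f.symm (f' ⟨x, hx⟩)).2
    have hsub : A.Subsingleton := fun b hb b' hb' => (hσ0 b hb).trans (hσ0 b' hb').symm
    have hle := Cardinal.mk_le_one_iff_set_subsingleton.2 hsub
    rw [hAκ] at hle
    have hlt : (1 : Cardinal) < Cardinal.lift.{u + 1} κ := by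
      rw [Cardinal.one_lt_lift_iff]
      exact Cardinal.one_lt_aleph0.trans hκω
    exact hlt.not_ge hle
  have hAμ : ∀ a ∈ A, Cardinal.mk a < Cardinal.lift.{u + 1} μ := by
    intro a ha
    rw [mk_eq_of_nonempty_orderIso_Iio (hA a ha).2, Cardinal.lift_lt]
    exact Cardinal.lt_ord.1 hσ
  have hrect := fun ν (hν : ν < κ.ord) => exists_forall_rectangle hμ hκ hC hΔ hcoh hhit' he hh
    (fun a ha => (hA a ha).1) hAμ hAd hAκ hν
  choose! k hkκ hk using hrect
  -- Closure under `k` puts `β'` above the threshold of every `α' < β'`; `α'` itself need not be in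
  -- the club.
  refine ⟨_, IsClubIn.closurePoints hκr hκω hkκ, ?_⟩
  rintro α' ⟨hα', -⟩ β' ⟨hβ', hD⟩ hlt
  obtain ⟨a, ha, b, hb, hax, hby, hcol⟩ := hk α' hα' β' (hD.2 α' hlt) hβ'
  refine ⟨a, ha, b, hb, fun x hx y hy => (hax x hx).2.trans_le (hby y hy), ?_⟩
  refine Set.eq_singleton_iff_nonempty_unique_mem.2
    ⟨((hne a ha).prod (hne b hb)).image _, ?_⟩
  rintro _ ⟨⟨x, y⟩, ⟨hx, hy⟩, rfl⟩
  have hc : c x y = (α', β') := hcol x hx y hy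
  simp only [hc]
  rw [if_pos ⟨(hax x hx).1, (hax x hx).2, hby y hy⟩]
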